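/- Let $\mathcal C$ be a category. Let $\mathcal C_{bi}$ be its trivial double category: both the horizontal and the vertical category of $\mathcal C_{bi}$ are $\mathcal C$, and the bicommutative squares are the commutative squares of $\mathcal C$. Let $N\mathcal C_{bi}$ be its nerve, the bisimplicial set whose $(p,q)$-simplices are the arrays of commutative squares in $\mathcal C$ with $p$ horizontal maps in each row and $q$ vertical maps in each column, and let $\operatorname{diag}(N\mathcal C_{bi})$ be its diagonal. The nerve $N\mathcal C$ is identified both with the simplicial set $(N\mathcal C_{bi})_{*,0}$ of arrays without vertical maps and with the simplicial set $(N\mathcal C_{bi})_{0,*}$ of arrays without horizontal maps, and the degeneracies give two edge maps $$f_1,f_2\colon N\mathcal C\longrightarrow \operatorname{diag}(N\mathcal C_{bi});$$ $f_1$ (resp. $f_2$) sends a chain $Y_0\to\cdots\to Y_n$ to the array with this chain along each row and identities as vertical maps (resp. with this chain along each column and identities as horizontal maps). Then: 1. $f_1$ and $f_2$ are weak equivalences of simplicial sets. 2. $f_1$ and $f_2$ represent the same map in the homotopy category of simplicial sets, that is, they become equal in the localization of the category of simplicial sets at the weak equivalences. 3. Sending an array $(X_{ij})_{0\le i,j\le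 n}$ of commutative squares to its diagonal chain $X_{00}\to X_{11}\to\cdots\to X_{nn}$ defines a map of simplicial sets $\chi\colon\operatorname{diag}(N\mathcal C_{bi})\to N\mathcal C$, and $\chi f_1=\chi f_2=\mathrm{id}_{N\mathcal C}$. -/

import Mathlib

open CategoryTheory Simplicial Opposite

universe v u w

/-- A double category with object set `O`: a category structure of `h`-maps and a category
structure of `v`-maps on `O`, and a collection of squares (the bicommutative squares), which contains
the degenerate squares on `v`-maps and on `h`-maps and is closed under horizontal and vertical
pasting. `IsSquare t l r b` says that the square with top `t`, left side `l`, right side `r` and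
bottom `b` belongs to the collection. -/
structure DoubleCategory (O : Type u) where
  horizontal : Category.{v} O
  vertical : Category.{v} O
  IsSquare : ∀ {W X Y Z : O}, horizontal.Hom W X → vertical.Hom W Y → vertical.Hom X Z →
    horizontal.Hom Y Z → Prop
  square_of_vertical : ∀ {X Y : O} (α : vertical.Hom X Y),
    IsSquare (horizontal.id X) α α (horizontal.id Y)
  square_of_horizontal : ∀ {X Y : O} (β : horizontal.Hom X Y),
    IsSquare β (vertical.id X) (vertical.id Y) β
  square_hcomp : ∀ {X₀ X₁ X₂ Y₀ Y₁ Y₂ : O}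
    {t₁ : horizontal.Hom X₀ X₁} {t₂ : horizontal.Hom X₁ X₂}
    {a₀ : vertical.Hom X₀ Y₀} {a₁ : vertical.Hom X₁ Y₁} {a₂ : vertical.Hom X₂ Y₂}
    {b₁ : horizontal.Hom Y₀ Y₁} {b₂ : horizontal.Hom Y₁ Y₂},
    IsSquare t₁ a₀ a₁ b₁ → IsSquare t₂ a₁ a₂ b₂ →
      IsSquare (horizontal.comp t₁ t₂) a₀ a₂ (horizontal.comp b₁ b₂)
  square_vcomp : ∀ {X₀ X₁ Y₀ Y₁ Z₀ Z₁ : O}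
    {t : horizontal.Hom X₀ X₁} {m : horizontal.Hom Y₀ Y₁} {b : horizontal.Hom Z₀ Z₁}
    {l₁ : vertical.Hom X₀ Y₀} {l₂ : vertical.Hom Y₀ Z₀}
    {r₁ : vertical.Hom X₁ Y₁} {r₂ : vertical.Hom Y₁ Z₁},
    IsSquare t l₁ r₁ m → IsSquare m l₂ r₂ b →
      IsSquare t (vertical.comp l₁ l₂) (vertical.comp r₁ r₂) b

namespace DoubleCategory

variable {O : Type u} (D : DoubleCategory.{v} O)

/-- The objects of `D`, seen as the objects of the category of `h`-maps. -/
def Horiz (_ : DoubleCategory.{v} O) : Type u := O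

/-- The objects of `D`, seen as the objects of the category of `v`-maps. -/
def Vert (_ : DoubleCategory.{v} O) : Type u := O

instance : Category.{v} D.Horiz := D.horizontal

instance : Category.{v} D.Vert := D.vertical

/-- A `v`-chain of length `q`: a sequence `X₀ ⟶ X₁ ⟶ ⋯ ⟶ X_q` of `v`-maps, that is, a functor
from the totally ordered set `{0 < ⋯ < q}` to the category of `v`-maps. -/
structure VChain (q : ℕ) where
  chain : ComposableArrows D.Vert q

namespace VChain

variable {D} {q : ℕ}

/-- The `i`-th object of a `v`-chain, as an object of the category of `h`-maps. -/
def obj (F : D.VChain q) (i : Fin (q + 1)) : D.Horiz := F.chain.obj i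

/-- The `v`-map between two objects of a `v`-chain. -/
def map (F : D.VChain q) {i j : Fin (q + 1)} (φ : i ⟶ j) :
    D.vertical.Hom (F.obj i) (F.obj j) := F.chain.map φ

/-- A morphism of `v`-chains: `h`-maps between corresponding objects, such that each `v`-map of
the chains gives a bicommutative square. -/
@[ext]
structure Hom (F G : D.VChain q) where
  app (i : Fin (q + 1)) : F.obj i ⟶ G.obj i
  square {i j : Fin (q + 1)} (φ : i ⟶ j) : D.IsSquare (app i) (F.map φ) (G.map φ) (app j)

/-- The category of `v`-chains of length `q` and `h`-maps between them. -/
instance : Category.{v} (D.VChain q) where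
  Hom := Hom
  id F := ⟨fun i ↦ 𝟙 (F.obj i), fun φ ↦ D.square_of_vertical (F.map φ)⟩
  comp f g := ⟨fun i ↦ f.app i ≫ g.app i, fun φ ↦ D.square_hcomp (f.square φ) (g.square φ)⟩
  id_comp f := Hom.ext (funext fun i ↦ Category.id_comp (f.app i))
  comp_id f := Hom.ext (funext fun i ↦ Category.comp_id (f.app i))
  assoc f g h := Hom.ext (funext fun i ↦ Category.assoc (f.app i) (g.app i) (h.app i))

/-- Reindexing of `v`-chains along a monotone map. -/
def reindex {p q : SimplexCategory} (θ : p ⟶ q) : D.VChain q.len ⥤ D.VChain p.len where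
  obj F := ⟨F.chain.whiskerLeft (SimplexCategory.toCat.map θ).toFunctor⟩
  map f := Hom.mk (fun i ↦ f.app (θ.toOrderHom i))
    (fun φ ↦ f.square ((SimplexCategory.toCat.map θ).toFunctor.map φ))
  map_id _ := rfl
  map_comp _ _ := rfl

end VChain

/-- The nerve of a double category, a bisimplicial set: the elements of
`((D.nerve.obj (op ⦋q⦌)).obj (op ⦋p⦌))` are the arrays of bicommutative squares with `p` `h`-maps in
each row and `q` `v`-maps in each column. For fixed `q` it is the nerve of the category of
`v`-chains of length `q` and `h`-maps between them. -/
def nerve : SimplexCategoryᵒᵖ ⥤ SSet.{max u v} where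
  obj q := CategoryTheory.nerve (D.VChain q.unop.len)
  map θ := nerveMap (VChain.reindex θ.unop)
  map_id _ := rfl
  map_comp _ _ := rfl

end DoubleCategory

/-- Bisimplicial sets; the simplicial set `B.obj (op ⦋q⦌)` is the `q`-th column. -/
abbrev BisimplicialSet := SimplexCategoryᵒᵖ ⥤ SSet.{w}

namespace BisimplicialSet

variable (B : BisimplicialSet.{w})

/-- The diagonal of a bisimplicial set. -/
def diag : SSet.{w} where
  obj n := (B.obj n).obj n
  map θ := (B.map θ).app _ ≫ (B.obj _).map θ
  map_id n := by
    rw [B.map_id, (B.obj n).map_id]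
    rfl
  map_comp {l m n} θ η := by
    rw [B.map_comp, (B.obj n).map_comp, NatTrans.comp_app, Category.assoc, Category.assoc,
      ← (B.map η).naturality_assoc θ]

/-- The `0`-th row of a bisimplicial set. -/
def zerothRow : SSet.{w} where
  obj n := (B.obj n).obj (op ⦋0⦌)
  map θ := (B.map θ).app _
  map_id n := by rw [B.map_id]; rfl
  map_comp θ η := by rw [B.map_comp]; rfl

/-- The unique map `n ⟶ ⦋0⦌` in the simplex category. -/
def toZero (n : SimplexCategory) : n ⟶ ⦋0⦌ := SimplexCategory.const n ⦋0⦌ 0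

/-- The map from the `0`-th column to the diagonal, given by the iterated degeneracies. -/
def zerothColumnToDiag : B.obj (op ⦋0⦌) ⟶ diag B where
  app n := (B.map (toZero n.unop).op).app n
  naturality {m n} θ := by
    have h : (toZero m.unop).op ≫ θ = (toZero n.unop).op := rfl
    have h' : (B.map (toZero n.unop).op) = B.map (toZero m.unop).op ≫ B.map θ := by
      rw [← B.map_comp, h]
    change _ = _ ≫ (B.map θ).app m ≫ (B.obj n).map θ
    rw [h', NatTrans.comp_app, ← (B.map θ).naturality θ, ← (B.map _).naturality_assoc θ]
    rfl

/-- The map from the `0`-th row to the diagonal, given by the iterated degeneracies. -/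
def zerothRowToDiag : zerothRow B ⟶ diag B where
  app n := (B.obj n).map (toZero n.unop).op
  naturality {m n} θ := by
    have h : (toZero m.unop).op ≫ θ = (toZero n.unop).op := rfl
    change (B.map θ).app (op ⦋0⦌) ≫ (B.obj n).map (toZero n.unop).op =
      (B.obj m).map (toZero m.unop).op ≫ (B.map θ).app m ≫ (B.obj n).map θ
    rw [(B.map θ).naturality_assoc, ← (B.obj n).map_comp, h]

end BisimplicialSet

namespace DoubleCategory

variable {O : Type u} (D : DoubleCategory.{v} O)

/-- The functor from the category of `h`-maps which sends an object `X` to the `v`-chain of length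
`0` that consists of `X`. -/
def chainZero : D.Horiz ⥤ D.VChain 0 where
  obj X := ⟨ComposableArrows.mk₀ (X : O)⟩
  map f := VChain.Hom.mk (fun _ ↦ f) (fun _ ↦ D.square_of_horizontal f)
  map_id _ := rfl
  map_comp _ _ := rfl

/-- The identification of the nerve of the category of `h`-maps with the `0`-th column of the
nerve of `D`. -/
def nerveHorizToColumn : CategoryTheory.nerve D.Horiz ⟶ D.nerve.obj (op ⦋0⦌) where
  app _ := ↾fun x ↦ x ⋙ D.chainZero
  naturality _ _ _ := rfl

/-- The identification of the nerve of the category of `v`-maps with the `0`-th row of the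
nerve of `D`. -/
def nerveVertToRow : CategoryTheory.nerve D.Vert ⟶ BisimplicialSet.zerothRow D.nerve where
  app n := ↾fun y ↦ ComposableArrows.mk₀ (⟨y⟩ : D.VChain n.unop.len)
  naturality _ _ _ := by
    ext y
    exact ComposableArrows.ext₀ rfl

/-- The edge map from the nerve of the category of `h`-maps to the diagonal of the nerve. -/
def edgeH : CategoryTheory.nerve D.Horiz ⟶ BisimplicialSet.diag D.nerve :=
  D.nerveHorizToColumn ≫ BisimplicialSet.zerothColumnToDiag D.nerve

/-- The edge map from the nerve of the category of `v`-maps to the diagonal of the nerve. -/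
def edgeV : CategoryTheory.nerve D.Vert ⟶ BisimplicialSet.diag D.nerve :=
  D.nerveVertToRow ≫ BisimplicialSet.zerothRowToDiag D.nerve

end DoubleCategory

section Trivial

variable (C : Type u) [Category.{v} C]

/-- The trivial double category of an ordinary category `C`: the `h`-maps and the `v`-maps are
the maps of `C`, and the bicommutative squares are the commutative squares. -/
def trivialDoubleCategory : DoubleCategory.{v} C where
  horizontal := inferInstance
  vertical := inferInstance
  IsSquare {_ _ _ _} t l r b := t ≫ r = l ≫ b
  square_of_vertical α := (Category.id_comp α).trans (Category.comp_id α).symm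
  square_of_horizontal β := (Category.comp_id β).trans (Category.id_comp β).symm
  square_hcomp {_ _ _ _ _ _} {t₁ t₂ a₀ a₁ a₂ b₁ b₂} h₁ h₂ := by
    change t₁ ≫ a₁ = a₀ ≫ b₁ at h₁
    change t₂ ≫ a₂ = a₁ ≫ b₂ at h₂
    change (t₁ ≫ t₂) ≫ a₂ = a₀ ≫ b₁ ≫ b₂
    rw [Category.assoc, h₂, ← Category.assoc, h₁, Category.assoc]
  square_vcomp {_ _ _ _ _ _} {t m b l₁ l₂ r₁ r₂} h₁ h₂ := by
    change t ≫ r₁ = l₁ ≫ m at h₁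
    change m ≫ r₂ = l₂ ≫ b at h₂
    change t ≫ r₁ ≫ r₂ = (l₁ ≫ l₂) ≫ b
    rw [Category.assoc, ← h₂, ← Category.assoc, h₁, Category.assoc]

/-- The diagonal simplicial set of the nerve of the trivial double category of `C`. -/
abbrev diagNerveTrivial : SSet.{max u v} :=
  BisimplicialSet.diag (trivialDoubleCategory C).nerve

/-- The horizontal edge map; it sends a chain `Y₀ ⟶ ⋯ ⟶ Yₙ` to the array which has this chain as
each of its rows and identities as vertical maps. -/
def trivialEdgeH : nerve C ⟶ diagNerveTrivial C := (trivialDoubleCategory C).edgeH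

/-- The vertical edge map; it sends a chain `Y₀ ⟶ ⋯ ⟶ Yₙ` to the array which has this chain as
each of its columns and identities as horizontal maps. -/
def trivialEdgeV : nerve C ⟶ diagNerveTrivial C := (trivialDoubleCategory C).edgeV

variable {C}

theorem diagonalChain_exchange {X₀ X₁ X₂ Y₁ Y₂ Z : C} {a : X₀ ⟶ X₁} {b : X₁ ⟶ X₂} {c : X₂ ⟶ Y₂}
    {d : Y₂ ⟶ Z} {e : X₁ ⟶ Y₁} {f : Y₁ ⟶ Y₂} (h : b ≫ c = e ≫ f) :
    (a ≫ b) ≫ c ≫ d = (a ≫ e) ≫ f ≫ d := by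
  rw [Category.assoc, Category.assoc, reassoc_of% h]

/-- The diagonal chain `X₀₀ ⟶ X₁₁ ⟶ ⋯ ⟶ Xₙₙ` of an `n × n` array of commutative squares. Its
maps are the composites of a horizontal map followed by a vertical map of the array. -/
def diagonalChain {n : SimplexCategoryᵒᵖ} (x : (diagNerveTrivial C).obj n) :
    (nerve C).obj n :=
  letI X : ComposableArrows ((trivialDoubleCategory C).VChain n.unop.len) n.unop.len := x
  letI Y : Fin (n.unop.len + 1) ⥤ C :=
    { obj i := (X.obj i).obj i
      map {i j} φ :=
        CategoryStruct.comp (obj := C) ((X.map φ).app i) ((X.obj j).map φ)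
      map_id i := by
        rw [X.map_id]
        exact (Category.id_comp (obj := C) _).trans ((X.obj i).chain.map_id i)
      map_comp {i j k} φ ψ := by
        have h : CategoryStruct.comp (obj := C) ((X.map ψ).app i) ((X.obj k).map φ) =
            CategoryStruct.comp (obj := C) ((X.obj j).map φ) ((X.map ψ).app j) :=
          (X.map ψ).square φ
        have e : (X.obj k).map (φ ≫ ψ) =
            CategoryStruct.comp (obj := C) ((X.obj k).map φ) ((X.obj k).map ψ) :=
          (X.obj k).chain.map_comp φ ψ
        have e' : (X.map (φ ≫ ψ)).app i =
            CategoryStruct.comp (obj := C) ((X.map φ).app i) ((X.map ψ).app i) := by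
          rw [X.map_comp]
          rfl
        rw [e, e']
        exact diagonalChain_exchange h }
  Y

end Trivial

namespace SSet

/-- The set `[X, K]` of simplicial homotopy classes of maps from `X` to `K`: the quotient of the
set of maps by the equivalence relation generated by simplicial homotopy (when `K` is a Kan complex,
simplicial homotopy already is an equivalence relation). -/
def HomotopyClasses (X K : SSet.{w}) : Type w :=
  Quot (fun f g : X ⟶ K ↦ Nonempty (SSet.Homotopy f g))

/-- Precomposition `[Y, K] → [X, K]` with a map `f : X ⟶ Y` of simplicial sets. -/
def HomotopyClasses.precomp {X Y : SSet.{w}} (f : X ⟶ Y) (K : SSet.{w}) :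
    HomotopyClasses Y K → HomotopyClasses X K :=
  Quot.map (fun g ↦ f ≫ g) (fun _ _ ⟨H⟩ ↦
    ⟨RelativeMorphism.Homotopy.precomp H (RelativeMorphism.botEquiv.symm f)
      (Subcomplex.isInitialBot.hom_ext _ _)⟩)

/-- The class of weak equivalences of simplicial sets: a map `f : X ⟶ Y` is a weak equivalence if
for every Kan complex `K` the induced map `[Y, K] → [X, K]` on simplicial homotopy classes is
bijective (equivalently, if its geometric realization is a homotopy equivalence). -/
def weakEquivalences : MorphismProperty SSet.{w} :=
  fun X Y f ↦ ∀ K : SSet.{w}, KanComplex K →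
    Function.Bijective (HomotopyClasses.precomp f K : HomotopyClasses Y K → HomotopyClasses X K)

/-- The homotopy category of simplicial sets: the localization of the category of simplicial sets
at the weak equivalences. -/
abbrev HoSSet := weakEquivalences.{w}.Localization

/-- The localization functor to the homotopy category. -/
abbrev toHoSSet : SSet.{w} ⥤ HoSSet.{w} := weakEquivalences.{w}.Q

end SSet

/-! An array of commutative squares is a functor from the grid `[n] × [n]` to `C`, so the diagonal
of the nerve is `gridNerve C` (`diagNerveTrivialIso`), `χ` is restriction to the diagonal, and `f₁`,
`f₂` are pullback along the two projections. Hence both are strict sections of `χ`. Going the other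
way, `χ` followed by an edge map reindexes arrays along `(i, j) ↦ (i, i)` or `(j, j)`. Natural
families of monotone grid maps that are pointwise comparable give homotopic reindexings
(`gridNerveHomotopy`), and both of these families, like the identity, lie below `(max i j, max i
j)`. The resulting zigzag of homotopies makes the edge maps weak equivalences. In the homotopy
category `χ` is then invertible, so its two sections agree. -/

namespace SSet

/-! ### Zigzags of homotopies and weak equivalences -/

variable {X Y Z : SSet.{w}}

/-- The equivalence relation on maps of simplicial sets generated by simplicial homotopy. -/
def HomotopyRel (f g : X ⟶ Y) : Prop :=
  Relation.EqvGen (fun f g : X ⟶ Y ↦ Nonempty (SSet.Homotopy f g)) f g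

/-- Postcomposition of a simplicial homotopy with a map. -/
noncomputable def Homotopy.postcompMap {f g : X ⟶ Y} (H : SSet.Homotopy f g) (k : Y ⟶ Z) :
    SSet.Homotopy (f ≫ k) (g ≫ k) :=
  RelativeMorphism.Homotopy.postcomp H (RelativeMorphism.botEquiv.symm k)
    (Subcomplex.isInitialBot.hom_ext _ _)

/-- Precomposition of a simplicial homotopy with a map. -/
noncomputable def Homotopy.precompMap {f g : Y ⟶ Z} (H : SSet.Homotopy f g) (k : X ⟶ Y) :
    SSet.Homotopy (k ≫ f) (k ≫ g) :=
  RelativeMorphism.Homotopy.precomp H (RelativeMorphism.botEquiv.symm k)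
    (Subcomplex.isInitialBot.hom_ext _ _)

theorem HomotopyRel.postcomp {f g : X ⟶ Y} (h : HomotopyRel f g) (k : Y ⟶ Z) :
    HomotopyRel (f ≫ k) (g ≫ k) := by
  induction h with
  | rel _ _ H => exact .rel _ _ ⟨H.some.postcompMap k⟩
  | refl _ => exact .refl _
  | symm _ _ _ ih => exact .symm _ _ ih
  | trans _ _ _ _ _ ih₁ ih₂ => exact .trans _ _ _ ih₁ ih₂

theorem HomotopyRel.precomp {f g : Y ⟶ Z} (h : HomotopyRel f g) (k : X ⟶ Y) :
    HomotopyRel (k ≫ f) (k ≫ g) := by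
  induction h with
  | rel _ _ H => exact .rel _ _ ⟨H.some.precompMap k⟩
  | refl _ => exact .refl _
  | symm _ _ _ ih => exact .symm _ _ ih
  | trans _ _ _ _ _ ih₁ ih₂ => exact .trans _ _ _ ih₁ ih₂

/-- A map with a strict retraction which is also a homotopy section is a weak equivalence. -/
theorem weakEquivalences_of_retraction {f : X ⟶ Y} {g : Y ⟶ X} (hfg : f ≫ g = 𝟙 X)
    (hgf : HomotopyRel (g ≫ f) (𝟙 Y)) : weakEquivalences f := by
  intro K _
  refine Function.bijective_iff_has_inverse.2 ⟨HomotopyClasses.precomp g K, ?_, ?_⟩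
  · rintro ⟨k⟩
    -- Homotopy classes are a quotient by the generated equivalence relation, so a zigzag of
    -- homotopies suffices.
    have h := hgf.postcomp k
    rw [Category.assoc, Category.id_comp] at h
    exact Quot.eqvGen_sound h
  · rintro ⟨k⟩
    refine congrArg (Quot.mk _) (?_ : f ≫ g ≫ k = k)
    rw [← Category.assoc, hfg, Category.id_comp]

end SSet

/-! ### Monotone maps of grids -/

/-- The partially ordered set of positions in an `n × n` array. -/
abbrev Grid (n : SimplexCategory) : Type := Fin (n.len + 1) × Fin (n.len + 1)

namespace Grid

/-- The map of grids induced by a map in the simplex category. -/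
def map {m n : SimplexCategory} (θ : m ⟶ n) : Grid m →o Grid n :=
  θ.toOrderHom.prodMap θ.toOrderHom

/-- The map `(i, j) ↦ (max i j, max i j)`. -/
def diagMax (n : SimplexCategory) : Grid n →o Grid n where
  toFun p := (max p.1 p.2, max p.1 p.2)
  monotone' _ _ h := ⟨max_le_max h.1 h.2, max_le_max h.1 h.2⟩

/-- The map which is `f` where `t` vanishes on the first coordinate, and `g` elsewhere. -/
def mix {n : SimplexCategory} (f g : Grid n →o Grid n) (h : f ≤ g)
    (t : Fin (n.len + 1) →o Fin 2) : Grid n →o Grid n where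
  toFun p := if t p.1 = 0 then f p else g p
  monotone' p q hpq := by
    have ht : t p.1 ≤ t q.1 := t.monotone hpq.1
    dsimp only
    split_ifs with h₁ h₂ h₂
    · exact f.monotone hpq
    -- The only crossing that occurs is from `f` to `g`, and this is where `f ≤ g` enters.
    · exact (f.monotone hpq).trans (h q)
    · exact absurd (le_antisymm (ht.trans h₂.le) (Fin.zero_le _)) h₁
    · exact g.monotone hpq

/-- A monotone map of grids as a functor. -/
def functor {m n : SimplexCategory} (f : Grid m →o Grid n) : Grid m ⥤ Grid n where
  obj p := f p
  map φ := (homOfLE (f.monotone ⟨leOfHom φ.1, leOfHom φ.2⟩).1,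
    homOfLE (f.monotone ⟨leOfHom φ.1, leOfHom φ.2⟩).2)

end Grid

/-! ### The nerve of grids and its reindexing homotopies -/

section GridNerve

variable (C : Type u) [Category.{v} C]

/-- The simplicial set whose `n`-simplices are the `n × n` arrays of commutative squares, seen as
functors from the grid. -/
def gridNerve : SSet.{max u v} where
  obj n := Grid n.unop ⥤ C
  map θ := ↾fun G ↦ Grid.functor (Grid.map θ.unop) ⋙ G
  map_id _ := rfl
  map_comp _ _ := rfl

variable {C}

theorem Grid.functor_congr {m n : SimplexCategory} {f g : Grid m →o Grid n} (h : f = g)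
    (G : Grid n ⥤ C) : Grid.functor f ⋙ G = Grid.functor g ⋙ G := by rw [h]

variable (C)

/-- The endomorphism of the nerve of grids given by a natural family of monotone maps. -/
def gridNerveReindex (f : ∀ n, Grid n →o Grid n)
    (hf : ∀ {m n : SimplexCategory} (θ : m ⟶ n),
      (Grid.map θ).comp (f m) = (f n).comp (Grid.map θ)) :
    gridNerve C ⟶ gridNerve C where
  app n := ↾fun G ↦ Grid.functor (f n.unop) ⋙ G
  naturality _ _ θ := by
    ext G
    exact Grid.functor_congr (hf θ.unop) G

/-- Comparable reindexings are homotopic. -/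
def gridNerveHomotopy (f g : ∀ n, Grid n →o Grid n)
    (hf : ∀ {m n : SimplexCategory} (θ : m ⟶ n),
      (Grid.map θ).comp (f m) = (f n).comp (Grid.map θ))
    (hg : ∀ {m n : SimplexCategory} (θ : m ⟶ n),
      (Grid.map θ).comp (g m) = (g n).comp (Grid.map θ))
    (h : ∀ n, f n ≤ g n) :
    SSet.Homotopy (gridNerveReindex C f hf) (gridNerveReindex C g hg) where
  h :=
    { app n := ↾fun x ↦ Grid.functor
        (Grid.mix (f n.unop) (g n.unop) (h n.unop) (SSet.stdSimplex.asOrderHom x.2)) ⋙ x.1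
      naturality m n θ := by
        ext x
        -- Both sides pull the same array back along a grid map, so it suffices to compare the grid
        -- maps: the case distinctions coincide, and `f` and `g` each commute with `θ`.
        refine (Grid.functor_congr (f := (Grid.map θ.unop).comp (Grid.mix _ _ (h _)
            ((SSet.stdSimplex.asOrderHom x.2).comp θ.unop.toOrderHom)))
          (g := (Grid.mix _ _ (h _) (SSet.stdSimplex.asOrderHom x.2)).comp (Grid.map θ.unop))
          ?_ x.1)
        ext1
        funext p
        change Grid.map θ.unop (ite _ _ _) = ite _ _ _
        rw [apply_ite (Grid.map θ.unop)]
        exact if_congr Iff.rfl (DFunLike.congr_fun (hf θ.unop) p)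
          (DFunLike.congr_fun (hg θ.unop) p) }
  h₀ := rfl
  h₁ := rfl
  rel := by
    ext n ⟨⟨_, hx⟩, _⟩
    exact hx.elim

/-- Restriction of an array to the diagonal. -/
def gridNerveDiag : gridNerve C ⟶ nerve C where
  app n := ↾fun G ↦ Functor.diag (Fin (n.unop.len + 1)) ⋙ G

/-- The array with the given chain along each row. -/
def nerveToGridFst : nerve C ⟶ gridNerve C where
  app n := ↾fun G ↦ CategoryTheory.Prod.fst (Fin (n.unop.len + 1)) (Fin (n.unop.len + 1)) ⋙ G

/-- The array with the given chain along each column. -/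
def nerveToGridSnd : nerve C ⟶ gridNerve C where
  app n := ↾fun G ↦ CategoryTheory.Prod.snd (Fin (n.unop.len + 1)) (Fin (n.unop.len + 1)) ⋙ G

theorem nerveToGridFst_diag : nerveToGridFst C ≫ gridNerveDiag C = 𝟙 _ := rfl

theorem nerveToGridSnd_diag : nerveToGridSnd C ≫ gridNerveDiag C = 𝟙 _ := rfl

/-- Monotone maps between linear orders preserve maxima; this makes the common upper bound natural.
-/
theorem Grid.map_comp_diagMax {m n : SimplexCategory} (θ : m ⟶ n) :
    (Grid.map θ).comp (Grid.diagMax m) = (Grid.diagMax n).comp (Grid.map θ) := by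
  ext1
  funext p
  exact Prod.ext (θ.toOrderHom.monotone.map_max) (θ.toOrderHom.monotone.map_max)

/-- A reindexing is homotopic to the identity if it is bounded by the reindexing along the maximum
of the two coordinates. -/
theorem gridNerveReindex_homotopyRel_id (f : ∀ n, Grid n →o Grid n)
    (hf : ∀ {m n : SimplexCategory} (θ : m ⟶ n),
      (Grid.map θ).comp (f m) = (f n).comp (Grid.map θ))
    (h : ∀ n, f n ≤ Grid.diagMax n) :
    SSet.HomotopyRel (gridNerveReindex C f hf) (𝟙 (gridNerve C)) :=
  .trans _ _ _
    -- `f` need not be comparable with the identity, so the path goes up to the maximum and back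
    -- down.
    (.rel _ _ ⟨gridNerveHomotopy C f Grid.diagMax hf Grid.map_comp_diagMax h⟩)
    (.symm _ _ (.rel _ _ ⟨gridNerveHomotopy C (fun _ ↦ OrderHom.id) Grid.diagMax (fun _ ↦ rfl)
      Grid.map_comp_diagMax (fun _ p ↦ ⟨le_max_left p.1 p.2, le_max_right p.1 p.2⟩)⟩))

theorem gridNerveDiag_fst_homotopyRel_id :
    SSet.HomotopyRel (gridNerveDiag C ≫ nerveToGridFst C) (𝟙 _) :=
  gridNerveReindex_homotopyRel_id C (fun _ ↦ OrderHom.diag.comp OrderHom.fst) (fun _ ↦ rfl)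
    (fun _ p ↦ ⟨le_max_left p.1 p.2, le_max_left p.1 p.2⟩)

theorem gridNerveDiag_snd_homotopyRel_id :
    SSet.HomotopyRel (gridNerveDiag C ≫ nerveToGridSnd C) (𝟙 _) :=
  gridNerveReindex_homotopyRel_id C (fun _ ↦ OrderHom.diag.comp OrderHom.snd) (fun _ ↦ rfl)
    (fun _ p ↦ ⟨le_max_right p.1 p.2, le_max_right p.1 p.2⟩)

end GridNerve

/-! ### Arrays of squares as functors on the grid -/

section Comparison

variable {C : Type u} [Category.{v} C]

/-- Needed in `ofGrid_toGrid`, where the chains on the two sides are equal only propositionally. -/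
theorem DoubleCategory.VChain.Hom.hext {O : Type u} {D : DoubleCategory.{v} O} {q : ℕ}
    {F F' G G' : D.VChain q} (hF : F = F') (hG : G = G') {f : F ⟶ G} {f' : F' ⟶ G'}
    (h : ∀ i, HEq (f.app i) (f'.app i)) : HEq f f' := by
  subst hF hG
  exact heq_of_eq (DoubleCategory.VChain.Hom.ext (funext fun i ↦ eq_of_heq (h i)))

/-- The functor from the grid given by an array of commutative squares. -/
def toGrid {n : SimplexCategory}
    (X : ComposableArrows ((trivialDoubleCategory C).VChain n.len) n.len) : Grid n ⥤ C where
  obj p := (X.obj p.1).obj p.2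
  map {p q} φ := CategoryStruct.comp (obj := C) ((X.map φ.1).app p.2) ((X.obj q.1).map φ.2)
  map_id p := by
    change CategoryStruct.comp (obj := C) ((X.map (𝟙 p.1)).app p.2) ((X.obj p.1).map (𝟙 p.2)) = _
    rw [X.map_id]
    exact (Category.id_comp (obj := C) _).trans ((X.obj p.1).chain.map_id p.2)
  map_comp {p q r} φ ψ := by
    have h : CategoryStruct.comp (obj := C) ((X.map ψ.1).app p.2) ((X.obj r.1).map φ.2) =
        CategoryStruct.comp (obj := C) ((X.obj q.1).map φ.2) ((X.map ψ.1).app q.2) :=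
      (X.map ψ.1).square φ.2
    have e : (X.obj r.1).map (φ.2 ≫ ψ.2) =
        CategoryStruct.comp (obj := C) ((X.obj r.1).map φ.2) ((X.obj r.1).map ψ.2) :=
      (X.obj r.1).chain.map_comp φ.2 ψ.2
    have e' : (X.map (φ.1 ≫ ψ.1)).app p.2 =
        CategoryStruct.comp (obj := C) ((X.map φ.1).app p.2) ((X.map ψ.1).app p.2) := by
      rw [X.map_comp]
      rfl
    change CategoryStruct.comp (obj := C) ((X.map (φ.1 ≫ ψ.1)).app p.2)
      ((X.obj r.1).map (φ.2 ≫ ψ.2)) = _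
    rw [e, e']
    exact diagonalChain_exchange h

/-- The array of commutative squares given by a functor from the grid. -/
def ofGrid {n : SimplexCategory} (G : Grid n ⥤ C) :
    ComposableArrows ((trivialDoubleCategory C).VChain n.len) n.len where
  obj i := ⟨(Functor.curryObj G).obj i⟩
  map φ := DoubleCategory.VChain.Hom.mk (((Functor.curryObj G).map φ).app)
    (fun ψ ↦ (((Functor.curryObj G).map φ).naturality ψ).symm)
  map_id i := DoubleCategory.VChain.Hom.ext (congrArg NatTrans.app ((Functor.curryObj G).map_id i))
  map_comp φ ψ :=
    DoubleCategory.VChain.Hom.ext (congrArg NatTrans.app ((Functor.curryObj G).map_comp φ ψ))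

theorem ofGrid_toGrid {n : SimplexCategory}
    (X : ComposableArrows ((trivialDoubleCategory C).VChain n.len) n.len) :
    ofGrid (toGrid X) = X := by
  have hobj (i : Fin (n.len + 1)) : (ofGrid (toGrid X)).obj i = X.obj i := by
    refine congrArg (DoubleCategory.VChain.mk (D := trivialDoubleCategory C)) ?_
    refine Functor.hext (fun _ ↦ rfl) (fun j k φ ↦ heq_of_eq ?_)
    change CategoryStruct.comp (obj := C) ((X.map (𝟙 i)).app j) ((X.obj i).map φ) =
      (X.obj i).map φ
    rw [X.map_id]
    exact Category.id_comp (obj := C) _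
  refine Functor.hext hobj (fun i j φ ↦ ?_)
  refine DoubleCategory.VChain.Hom.hext (hobj i) (hobj j) (fun k ↦ heq_of_eq ?_)
  change CategoryStruct.comp (obj := C) ((X.map φ).app k) ((X.obj j).chain.map (𝟙 k)) =
    (X.map φ).app k
  rw [(X.obj j).chain.map_id]
  exact Category.comp_id (obj := C) _

theorem toGrid_ofGrid {n : SimplexCategory} (G : Grid n ⥤ C) : toGrid (ofGrid G) = G := by
  refine Functor.hext (fun _ ↦ rfl) (fun p q φ ↦ heq_of_eq ?_)
  -- Every grid map factors as a horizontal step followed by a vertical one.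
  exact (G.map_comp (X := p) (Y := (q.1, p.2)) (Z := q) (φ.1, 𝟙 p.2) (𝟙 q.1, φ.2)).symm

variable (C)

/-- The diagonal of the nerve of the trivial double category is the nerve of grids. -/
def diagNerveTrivialIso : diagNerveTrivial C ≅ gridNerve C where
  hom := { app _ := ↾fun X ↦ toGrid X }
  inv := { app _ := ↾fun G ↦ ofGrid G }
  hom_inv_id := by
    ext n X
    exact ofGrid_toGrid X
  inv_hom_id := by
    ext n G
    exact toGrid_ofGrid G

theorem trivialEdgeH_hom :
    trivialEdgeH C ≫ (diagNerveTrivialIso C).hom = nerveToGridFst C := by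
  ext n G
  refine Functor.hext (fun _ ↦ rfl) (fun p q φ ↦ heq_of_eq ?_)
  exact Category.comp_id (obj := C) _

theorem trivialEdgeV_hom :
    trivialEdgeV C ≫ (diagNerveTrivialIso C).hom = nerveToGridSnd C := by
  ext n G
  refine Functor.hext (fun _ ↦ rfl) (fun p q φ ↦ heq_of_eq ?_)
  exact Category.id_comp (obj := C) _

/-- The map which sends an array to its diagonal chain. -/
def diagonalChainMap : diagNerveTrivial C ⟶ nerve C :=
  (diagNerveTrivialIso C).hom ≫ gridNerveDiag C

theorem trivialEdgeH_diagonalChainMap : trivialEdgeH C ≫ diagonalChainMap C = 𝟙 _ := by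
  rw [diagonalChainMap, ← Category.assoc, trivialEdgeH_hom, nerveToGridFst_diag]

theorem trivialEdgeV_diagonalChainMap : trivialEdgeV C ≫ diagonalChainMap C = 𝟙 _ := by
  rw [diagonalChainMap, ← Category.assoc, trivialEdgeV_hom, nerveToGridSnd_diag]

/-- Homotopy of a self-map of the nerve of grids to the identity transfers to the diagonal of the
nerve of the trivial double category. -/
theorem diagonalChainMap_comp_homotopyRel_id {e : nerve C ⟶ diagNerveTrivial C}
    (h : SSet.HomotopyRel (gridNerveDiag C ≫ e ≫ (diagNerveTrivialIso C).hom) (𝟙 _)) :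
    SSet.HomotopyRel (diagonalChainMap C ≫ e) (𝟙 _) := by
  have h' := (h.postcomp (diagNerveTrivialIso C).inv).precomp (diagNerveTrivialIso C).hom
  simpa only [Category.assoc, Category.id_comp, Category.comp_id, Iso.hom_inv_id] using! h'

theorem weakEquivalences_trivialEdgeH : SSet.weakEquivalences (trivialEdgeH C) :=
  SSet.weakEquivalences_of_retraction (trivialEdgeH_diagonalChainMap C)
    (diagonalChainMap_comp_homotopyRel_id C (by
      rw [trivialEdgeH_hom]
      exact gridNerveDiag_fst_homotopyRel_id C))

theorem weakEquivalences_trivialEdgeV : SSet.weakEquivalences (trivialEdgeV C) :=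
  SSet.weakEquivalences_of_retraction (trivialEdgeV_diagonalChainMap C)
    (diagonalChainMap_comp_homotopyRel_id C (by
      rw [trivialEdgeV_hom]
      exact gridNerveDiag_snd_homotopyRel_id C))

end Comparison

/-! ### Passage to the homotopy category -/

/-- Two sections of the same map become equal in the homotopy category if one of them is a weak
equivalence. -/
theorem SSet.toHoSSet_map_eq_of_retraction {X Y : SSet.{w}} {f₁ f₂ : X ⟶ Y} {g : Y ⟶ X}
    (hf : SSet.weakEquivalences f₁) (h₁ : f₁ ≫ g = 𝟙 X) (h₂ : f₂ ≫ g = 𝟙 X) :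
    SSet.toHoSSet.map f₁ = SSet.toHoSSet.map f₂ := by
  have : IsIso (SSet.toHoSSet.map f₁) := SSet.weakEquivalences.Q_inverts _ hf
  have h : SSet.toHoSSet.map f₁ ≫ SSet.toHoSSet.map g = 𝟙 _ := by
    rw [← Functor.map_comp, h₁, CategoryTheory.Functor.map_id]
  have : IsIso (SSet.toHoSSet.map g) := by
    rw [IsIso.eq_inv_of_hom_inv_id h]
    infer_instance
  rw [← cancel_mono (SSet.toHoSSet.map g), h, ← Functor.map_comp, h₂, CategoryTheory.Functor.map_id]

theorem proposition3p1 (C : Type u) [Category.{v} C] :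
    SSet.weakEquivalences (trivialEdgeH C) ∧
    SSet.weakEquivalences (trivialEdgeV C) ∧
    SSet.toHoSSet.map (trivialEdgeH C) = SSet.toHoSSet.map (trivialEdgeV C) ∧
    ∃ χ : diagNerveTrivial C ⟶ nerve C,
      (∀ (n : SimplexCategoryᵒᵖ) (x : (diagNerveTrivial C).obj n), χ.app n x = diagonalChain x) ∧
      trivialEdgeH C ≫ χ = 𝟙 (nerve C) ∧
      trivialEdgeV C ≫ χ = 𝟙 (nerve C) :=
  ⟨weakEquivalences_trivialEdgeH C, weakEquivalences_trivialEdgeV C,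
    SSet.toHoSSet_map_eq_of_retraction (weakEquivalences_trivialEdgeH C)
      (trivialEdgeH_diagonalChainMap C) (trivialEdgeV_diagonalChainMap C),
    -- `toGrid` composes horizontal before vertical, exactly as `diagonalChain` does, hence `rfl`.
    diagonalChainMap C, fun _ _ ↦ rfl, trivialEdgeH_diagonalChainMap C,
    trivialEdgeV_diagonalChainMap C⟩
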